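/- Let $d,N\in\mathbb N$, let $\Omega\subset\mathbb R^d$ be a non-empty, bounded, open set, and let $\Phi\colon[0,\infty)^N\to[0,\infty)$. All sets are Lebesgue measurable, $|E|$ denotes Lebesgue measure, inclusions are meant up to null sets, and $|Du|(\mathbb R^d)=\sup\{\int u\,\mathrm{div}\,\varphi : \varphi\in C^1_c(\mathbb R^d;\mathbb R^d),\ |\varphi|\le 1\}$, $\mathrm{Per}(E)=|D\chi_E|(\mathbb R^d)$. For $v,w\in[0,\infty)^N$ write $v\le w$ if $v_i\le w_i$ for all $i$, and $v<w$ if $v\le w$ and $v_i<w_i$ for some $i$. The function $\Phi$ is increasing if $v\le w$ implies $\Phi(v)\le\Phi(w)$, and strictly increasing if $v<w$ implies $\Phi(v)<\Phi(w)$. An $N$-cluster of $\Omega$ is an $N$-tuple $\mathcal E=(\mathcal E_1,\dots,\mathcal E_N)$ of subsets of $\Omega$ with $|\mathcal E_i|>0$, $\mathrm{Per}(\mathcal E_i)<\infty$ and $|\mathcal E_i\cap\mathcal E_j|=0$ for $i\ne j$. The $(\Phi,N)$-Cheeger constant is $$H^{\Phi,N}(\Omega)=\inf\left\{\Phi\left(\frac{\mathrm{Per}(\mathcal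 E_1)}{|\mathcal E_1|},\dots,\frac{\mathrm{Per}(\mathcal E_N)}{|\mathcal E_N|}\right):\ \mathcal E\text{ is an }N\text{-cluster of }\Omega\right\}\in[0,\infty],$$ and an $N$-cluster achieving the infimum is a $\Phi$-Cheeger $N$-cluster of $\Omega$. An $N$-cluster $\mathcal E$ of $\Omega$ is $1$-adjusted if $\mathrm{Per}(\mathcal E_i)/|\mathcal E_i|=h\big(\Omega\setminus\bigcup_{j\ne i}\mathcal E_j\big)$ for every $i$, where $h(F)=\inf\{\mathrm{Per}(E)/|E| : E\subset F,\ |E|>0\}$ is the Cheeger constant of $F$. A $(1,N)$-function of $\Omega$ is an $N$-tuple $u=(u_1,\dots,u_N)$ of functions $u_i\in BV(\mathbb R^d)$ with $u_i=0$ a.e. in $\mathbb R^d\setminus\Omega$, $u_i\ge0$, $\|u_i\|_{L^1}=1$ and $u_iu_j=0$ a.e. in $\Omega$ for $i\neq j$. Put $$\Lambda^{\Phi,N}_{1,1}(\Omega)=\inf\left\{\Phi\big(|Du_1|(\mathbb R^d),\dots,|Du_N|(\mathbb R^d)\big):\ u\text{ is a }(1,N)\text{-function of }\Omega\right\}\in[0,\infty],$$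 and call a $(1,N)$-function achieving the infimum a $(1,\Phi)$-eigen-$N$-function of $\Omega$. **Theorem.** If $\Phi$ is increasing, then $\Lambda^{\Phi,N}_{1,1}(\Omega)=H^{\Phi,N}(\Omega)$. Moreover, if $\Phi$ is strictly increasing, then a $(1,N)$-function $u$ of $\Omega$ is a $(1,\Phi)$-eigen-$N$-function of $\Omega$ if and only if, for a.e. $t_i>0$ such that $|\{u_i>t_i\}|>0$, $i=1,\dots,N$, the $N$-tuple $(\{u_1>t_1\},\dots,\{u_N>t_N\})$ is a $1$-adjusted $\Phi$-Cheeger $N$-cluster of $\Omega$. The equivalence holds both when "a.e." refers to almost every vector $(t_1,\dots,t_N)$ with respect to Lebesgue measure on $\mathbb R^N$ and when it means all such $t_i\notin Z_i$ for suitable null sets $Z_1,\dots,Z_N\subset\mathbb R$. In particular, if $\Phi$ is strictly increasing and $\mathcal E$ is a $\Phi$-Cheeger $N$-cluster of $\Omega$, then $\left(\chi_{\mathcal E_1}/|\mathcal E_1|,\dots,\chi_{\mathcal E_N}/|\mathcal E_N|\right)$ is a $(1,\Phi)$-eigen-$N$-function of $\Omega$. -/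

import Mathlib

open MeasureTheory
open scoped ENNReal NNReal

namespace NCheeger

/-- Euclidean space `ℝ^d`, with its Euclidean norm and Lebesgue measure. -/
abbrev Eucl (d : ℕ) : Type := EuclideanSpace ℝ (Fin d)

/-- The divergence `∑ i, ∂_i φ_i` of a vector field on `ℝ^d`. -/
noncomputable def divergence {d : ℕ} (φ : Eucl d → Eucl d) (x : Eucl d) : ℝ :=
  ∑ i : Fin d, (fderiv ℝ φ x (EuclideanSpace.single i 1)) i

/-- Admissible fields in the definition of the total variation: `φ ∈ C_c^1(ℝ^d; ℝ^d)` with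
`|φ(x)| ≤ 1` for every `x`. -/
structure IsTestField {d : ℕ} (φ : Eucl d → Eucl d) : Prop where
  contDiff : ContDiff ℝ 1 φ
  hasCompactSupport : HasCompactSupport φ
  norm_le_one : ∀ x, ‖φ x‖ ≤ 1

/-- The total variation `|Du|(ℝ^d) = sup {∫ u div φ : φ ∈ C_c^1(ℝ^d; ℝ^d), |φ| ≤ 1} ∈ [0, ∞]`
of a locally integrable function `u`. -/
noncomputable def totalVariation {d : ℕ} (u : Eucl d → ℝ) : ℝ≥0∞ :=
  ⨆ (φ : Eucl d → Eucl d) (_ : IsTestField φ), ENNReal.ofReal (∫ x, u x * divergence φ x)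

/-- The Euclidean perimeter of a Lebesgue measurable set, i.e. the total variation of its
characteristic function. -/
noncomputable def perimeter {d : ℕ} (E : Set (Eucl d)) : ℝ≥0∞ :=
  totalVariation (E.indicator fun _ => (1 : ℝ))

/-- `u ∈ BV₀(F)`: `u ∈ BV(ℝ^d)` (that is, `u ∈ L¹(ℝ^d)` has finite total variation) and
`u = 0` a.e. in `ℝ^d \ F`. -/
structure MemBVZero {d : ℕ} (F : Set (Eucl d)) (u : Eucl d → ℝ) : Prop where
  integrable : Integrable u
  totalVariation_lt_top : totalVariation u < ∞
  ae_eq_zero : ∀ᵐ x, x ∉ F → u x = 0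

/-- The Cheeger constant `h(F) = inf {Per(E) / |E| : E ⊆ F, |E| > 0} ∈ [0, ∞]`, over Lebesgue
measurable sets `E`, the inclusion being meant up to null sets. It is used for sets `F` of
finite measure only. -/
noncomputable def cheeger {d : ℕ} (F : Set (Eucl d)) : ℝ≥0∞ :=
  ⨅ (E : Set (Eucl d)) (_ : NullMeasurableSet E ∧ volume (E \ F) = 0 ∧ 0 < volume E),
    perimeter E / volume E

/-- `N`-sets of `F`: Lebesgue measurable sets of positive measure, contained in `F` and pairwise
disjoint up to null sets. -/
structure IsNSet {d N : ℕ} (F : Set (Eucl d)) (E : Fin N → Set (Eucl d)) : Prop where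
  nullMeasurableSet : ∀ i, NullMeasurableSet (E i)
  subset : ∀ i, volume (E i \ F) = 0
  volume_pos : ∀ i, 0 < volume (E i)
  disjoint : ∀ i j, i ≠ j → volume (E i ∩ E j) = 0

/-- `N`-clusters of `F`: `N`-sets of `F` whose chambers have finite perimeter. -/
structure IsNCluster {d N : ℕ} (F : Set (Eucl d)) (E : Fin N → Set (Eucl d)) : Prop
    extends IsNSet F E where
  perimeter_lt_top : ∀ i, perimeter (E i) < ∞

/-- `1`-adjusted `N`-clusters of `F`: `Per(E_i) / |E_i| = h(F \ ⋃_{j ≠ i} E_j)` for every `i`. -/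
def IsOneAdjusted {d N : ℕ} (F : Set (Eucl d)) (E : Fin N → Set (Eucl d)) : Prop :=
  IsNCluster F E ∧
    ∀ i, perimeter (E i) / volume (E i) = cheeger (F \ ⋃ (j : Fin N) (_ : j ≠ i), E j)

/-- The vector `(Per(E_1) / |E_1|, …, Per(E_N) / |E_N|)`. Its entries are finite when `E` is an
`N`-cluster, so that `toNNReal` does not change them. -/
noncomputable def ratio {d N : ℕ} (E : Fin N → Set (Eucl d)) : Fin N → ℝ≥0 :=
  fun i => (perimeter (E i) / volume (E i)).toNNReal

/-- The `(Φ, N)`-Cheeger constant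
`H^{Φ,N}(F) = inf {Φ(Per(E) / |E|) : E is an N-cluster of F} ∈ [0, ∞]`. -/
noncomputable def cheegerH {d N : ℕ} (Φ : (Fin N → ℝ≥0) → ℝ≥0) (F : Set (Eucl d)) : ℝ≥0∞ :=
  ⨅ (E : Fin N → Set (Eucl d)) (_ : IsNCluster F E), (Φ (ratio E) : ℝ≥0∞)

/-- `Φ`-Cheeger `N`-clusters of `F`: `N`-clusters achieving the infimum `H^{Φ,N}(F)`. -/
def IsCheegerCluster {d N : ℕ} (Φ : (Fin N → ℝ≥0) → ℝ≥0) (F : Set (Eucl d))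
    (E : Fin N → Set (Eucl d)) : Prop :=
  IsNCluster F E ∧ (Φ (ratio E) : ℝ≥0∞) = cheegerH Φ F

/-- `(1, N)`-functions of `F`: `N`-tuples of nonnegative functions in `BV₀(F)` with unit `L¹` norm
and `u_i u_j = 0` a.e. in `F` for `i ≠ j`. -/
structure IsOneNFunction {d N : ℕ} (F : Set (Eucl d)) (u : Fin N → Eucl d → ℝ) : Prop where
  memBVZero : ∀ i, MemBVZero F (u i)
  nonneg : ∀ i, ∀ᵐ x, 0 ≤ u i x
  norm_eq_one : ∀ i, ∫ x, |u i x| = 1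
  mul_eq_zero : ∀ i j, i ≠ j → ∀ᵐ x, x ∈ F → u i x * u j x = 0

/-- The vector `[u]_1 = (|Du_1|(ℝ^d), …, |Du_N|(ℝ^d))`. Its entries are finite when every `u_i`
has bounded variation, so that `toNNReal` does not change them. -/
noncomputable def variationVector {d N : ℕ} (u : Fin N → Eucl d → ℝ) : Fin N → ℝ≥0 :=
  fun i => (totalVariation (u i)).toNNReal

/-- The first `1`-functional `(Φ, N)`-eigenvalue
`Λ_{1,1}^{Φ,N}(F) = inf {Φ([u]_1) : u is a (1, N)-function of F} ∈ [0, ∞]`. -/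
noncomputable def functionalEigenvalue {d N : ℕ} (Φ : (Fin N → ℝ≥0) → ℝ≥0) (F : Set (Eucl d)) :
    ℝ≥0∞ :=
  ⨅ (u : Fin N → Eucl d → ℝ) (_ : IsOneNFunction F u), (Φ (variationVector u) : ℝ≥0∞)

/-- `(1, Φ)`-eigen-`N`-functions of `F`: `(1, N)`-functions achieving the infimum
`Λ_{1,1}^{Φ,N}(F)`. -/
def IsEigenFunction {d N : ℕ} (Φ : (Fin N → ℝ≥0) → ℝ≥0) (F : Set (Eucl d))
    (u : Fin N → Eucl d → ℝ) : Prop :=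
  IsOneNFunction F u ∧ (Φ (variationVector u) : ℝ≥0∞) = functionalEigenvalue Φ F

/-- The `N`-tuple of superlevel sets `({u_1 > t_1}, …, {u_N > t_N})`. -/
def superlevel {d N : ℕ} (u : Fin N → Eucl d → ℝ) (t : Fin N → ℝ) : Fin N → Set (Eucl d) :=
  fun i => {x | t i < u i x}

/-- The `N`-tuple of functions `(χ_{E_1} / |E_1|, …, χ_{E_N} / |E_N|)`. -/
noncomputable def clusterFunction {d N : ℕ} (E : Fin N → Set (Eucl d)) : Fin N → Eucl d → ℝ :=
  fun i => (E i).indicator fun _ => (volume (E i)).toReal⁻¹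

end NCheeger

open NCheeger

namespace NCheeger

open Filter Topology

/-! ### Test fields and the divergence -/

section TestFields

variable {d : ℕ} {φ : Eucl d → Eucl d}

/-! The engine is the coarea formula. For `u ≥ 0` with unit `L¹` norm, `|Du| = ∫₀^∞ Per{u > t} dt`
while `1 = ∫₀^∞ |{u > t}| dt`, so `|Du|` is the average of the ratios `Per{u > t} / |{u > t}|` with
weight `|{u > t}| dt`.

Hence some superlevel set has ratio at most `|Du|`. Positive superlevel sets of different components
are disjoint up to null sets, so the levels can be chosen independently; this gives `H ≤ Λ`. The
converse holds because the normalized indicators of a cluster have the ratios of the cluster as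
variations.

If `Φ` is strictly increasing, no superlevel set of an eigenfunction has ratio below `|Du_i|`, since
its normalized indicator could replace `u_i` and lower `Φ`. An average of values at least `|Du_i|`
that equals `|Du_i|` is attained almost everywhere, so almost all superlevel tuples are minimizing
clusters. The same replacement on chambers makes minimizers `1`-adjusted. Conversely, levels with
ratio at least `|Du_i|` are not negligible; at a good vector of such levels, the minimality of the
cluster passes to `u`.

Coarea enters as two inequalities: `totalVariation_le_lintegral_perimeter`, by the layer cake
formula, and `exists_density_of_integrable`, by mollifying the smooth case. The latter supplies a
measurable majorant of `t ↦ Per{u > t}`, so that the measurability of the perimeter in `t` is never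
needed. -/

theorem continuous_divergence (hφ : ContDiff ℝ 1 φ) : Continuous (divergence φ) := by
  have h := hφ.continuous_fderiv one_ne_zero
  unfold divergence
  fun_prop

theorem hasCompactSupport_divergence (hφ : HasCompactSupport φ) :
    HasCompactSupport (divergence φ) := by
  refine (hφ.fderiv (𝕜 := ℝ)).comp_left
    (g := fun L : Eucl d →L[ℝ] Eucl d => ∑ i, (L (EuclideanSpace.single i 1)) i) ?_
  simp

theorem IsTestField.integrable_divergence (hφ : IsTestField φ) :
    Integrable (divergence φ) :=
  (continuous_divergence hφ.contDiff).integrable_of_hasCompactSupport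
    (hasCompactSupport_divergence hφ.hasCompactSupport)

theorem IsTestField.exists_abs_divergence_le (hφ : IsTestField φ) :
    ∃ C, ∀ x, |divergence φ x| ≤ C :=
  (continuous_divergence hφ.contDiff).bounded_above_of_compact_support
    (hasCompactSupport_divergence hφ.hasCompactSupport)

theorem IsTestField.integrable_mul_divergence (hφ : IsTestField φ) {u : Eucl d → ℝ}
    (hu : Integrable u) : Integrable fun x => u x * divergence φ x := by
  obtain ⟨C, hC⟩ := hφ.exists_abs_divergence_le
  exact hu.mul_bdd (continuous_divergence hφ.contDiff).aestronglyMeasurable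
    (ae_of_all _ fun x => by simpa using hC x)

/-- Translates of test fields are test fields. -/
theorem IsTestField.comp_add_right (hφ : IsTestField φ) (z : Eucl d) :
    IsTestField fun x => φ (x + z) where
  contDiff := hφ.contDiff.comp (contDiff_id.add contDiff_const)
  hasCompactSupport := hφ.hasCompactSupport.comp_homeomorph (Homeomorph.addRight z)
  norm_le_one _ := hφ.norm_le_one _

theorem divergence_comp_add_right (z x : Eucl d) :
    divergence (fun y => φ (y + z)) x = divergence φ (x + z) := by
  simp only [divergence, fderiv_comp_add_right]

/-- Integration by parts against a compactly supported field. -/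
theorem integral_mul_divergence {w : Eucl d → ℝ} (hw : ContDiff ℝ 1 w)
    (hφ : ContDiff ℝ 1 φ) (hc : HasCompactSupport φ) :
    ∫ x, w x * divergence φ x = -∫ x, fderiv ℝ w x (φ x) := by
  have hfφ := hφ.continuous_fderiv one_ne_zero
  have hfw := hw.continuous_fderiv one_ne_zero
  have hcw := hw.continuous
  have hcφ := hφ.continuous
  have hcoord : ∀ i x, fderiv ℝ (fun y => φ y i) x (EuclideanSpace.single i 1)
      = (fderiv ℝ φ x (EuclideanSpace.single i 1)) i := by
    intro i x
    have h1 : HasFDerivAt (fun y => φ y i)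
        ((EuclideanSpace.proj i : Eucl d →L[ℝ] ℝ).comp (fderiv ℝ φ x)) x :=
      (EuclideanSpace.proj i : Eucl d →L[ℝ] ℝ).hasFDerivAt.comp x
        (hφ.differentiable one_ne_zero x).hasFDerivAt
    rw [h1.fderiv]
    rfl
  have hc0 : ∀ x, x ∉ tsupport φ → φ x = 0 := fun x hx => image_eq_zero_of_notMem_tsupport hx
  have hc1 : ∀ x, x ∉ tsupport φ → fderiv ℝ φ x = 0 := fun x hx =>
    image_eq_zero_of_notMem_tsupport fun h => hx (tsupport_fderiv_subset ℝ h)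
  have hI : ∀ {g : Eucl d → ℝ}, Continuous g → (∀ x, x ∉ tsupport φ → g x = 0) →
      Integrable g := fun hg h0 =>
    hg.integrable_of_hasCompactSupport (HasCompactSupport.intro hc h0)
  have key : ∀ i : Fin d,
      ∫ x, w x * (fderiv ℝ φ x (EuclideanSpace.single i 1)) i
        = -∫ x, fderiv ℝ w x (EuclideanSpace.single i 1) * φ x i := by
    intro i
    have := integral_mul_fderiv_eq_neg_fderiv_mul_of_integrable (μ := (volume : Measure (Eucl d)))
      (f := w) (g := fun y => φ y i) (v := EuclideanSpace.single i 1)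
      (hI (by fun_prop) fun x hx => by simp [hc0 x hx])
      (by
        simp only [hcoord]
        exact hI (by fun_prop) fun x hx => by simp [hc1 x hx])
      (hI (by fun_prop) fun x hx => by simp [hc0 x hx])
      (fun x _ => hw.differentiable one_ne_zero x)
      (fun x _ => by
        have := hφ.differentiable one_ne_zero x
        fun_prop)
    simpa only [hcoord] using this
  have hexp : ∀ x, fderiv ℝ w x (φ x)
      = ∑ i, fderiv ℝ w x (EuclideanSpace.single i 1) * φ x i := by
    intro x
    conv_lhs => rw [← (EuclideanSpace.basisFun (Fin d) ℝ).sum_repr (φ x)]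
    simp [mul_comm]
  simp only [divergence, Finset.mul_sum, hexp]
  rw [integral_finsetSum, integral_finsetSum, ← Finset.sum_neg_distrib]
  · exact Finset.sum_congr rfl fun i _ => key i
  · exact fun i _ => hI (by fun_prop) fun x hx => by simp [hc0 x hx]
  · exact fun i _ => hI (by fun_prop) fun x hx => by simp [hc1 x hx]

end TestFields

/-! ### Total variation and perimeter -/

section TotalVariation

variable {d : ℕ} {u v : Eucl d → ℝ} {φ : Eucl d → Eucl d}

theorem IsTestField.le_totalVariation (hφ : IsTestField φ) (u : Eucl d → ℝ) :
    ENNReal.ofReal (∫ x, u x * divergence φ x) ≤ totalVariation u :=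
  le_iSup₂ (f := fun (φ : Eucl d → Eucl d) (_ : IsTestField φ) =>
    ENNReal.ofReal (∫ x, u x * divergence φ x)) φ hφ

theorem IsTestField.integral_le_toReal_totalVariation (hφ : IsTestField φ)
    (hu : totalVariation u ≠ ∞) :
    ∫ x, u x * divergence φ x ≤ (totalVariation u).toReal :=
  (ENNReal.ofReal_le_iff_le_toReal hu).1 (hφ.le_totalVariation u)

theorem totalVariation_congr_ae (h : u =ᵐ[volume] v) : totalVariation u = totalVariation v := by
  unfold totalVariation
  congr! 3 with φ hφ
  congr 1
  exact integral_congr_ae (h.mono fun x hx => by simp only [hx])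

theorem perimeter_congr_ae {E F : Set (Eucl d)} (h : E =ᵐ[volume] F) :
    perimeter E = perimeter F :=
  totalVariation_congr_ae (indicator_ae_eq_of_ae_eq_set h)

theorem totalVariation_const_mul {c : ℝ} (hc : 0 ≤ c) (u : Eucl d → ℝ) :
    totalVariation (fun x => c * u x) = ENNReal.ofReal c * totalVariation u := by
  simp only [totalVariation, ENNReal.mul_iSup, mul_assoc, integral_const_mul,
    ENNReal.ofReal_mul hc]

theorem IsTestField.le_perimeter (hφ : IsTestField φ) {E : Set (Eucl d)}
    (hE : NullMeasurableSet E) :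
    ENNReal.ofReal (∫ x in E, divergence φ x) ≤ perimeter E := by
  refine le_trans (le_of_eq ?_) (hφ.le_totalVariation _)
  rw [← integral_indicator₀ hE]
  congr 2 with x
  by_cases hx : x ∈ E <;> simp [hx]

/-- The `L¹` norm of the gradient is bounded by the total variation. -/
theorem lintegral_enorm_fderiv_le (hv : ContDiff ℝ 2 v) (hc : HasCompactSupport v) :
    ∫⁻ x, ‖fderiv ℝ v x‖ₑ ≤ totalVariation v := by
  rcases eq_or_ne (totalVariation v) ∞ with htop | htop
  · simp [htop]
  have hfd : ContDiff ℝ 1 (fderiv ℝ v) := hv.fderiv_right (by norm_num)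
  have hcf : HasCompactSupport (fderiv ℝ v) := hc.fderiv (𝕜 := ℝ)
  set X : Eucl d → Eucl d := fun x => (InnerProductSpace.toDual ℝ (Eucl d)).symm (fderiv ℝ v x)
    with hX
  have hXc : ContDiff ℝ 1 X :=
    (InnerProductSpace.toDual ℝ (Eucl d)).symm.contDiff.comp hfd
  have hXn : ∀ x, ‖X x‖ = ‖fderiv ℝ v x‖ := fun x => LinearIsometryEquiv.norm_map _ _
  have hXi : ∀ x y, fderiv ℝ v x y = inner ℝ (X x) y := fun x y => by
    simp [hX]
  have hint : Integrable fun x => ‖fderiv ℝ v x‖ :=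
    (hfd.continuous.integrable_of_hasCompactSupport hcf).norm
  set K := tsupport (fderiv ℝ v) with hK
  have hKf : volume K ≠ ∞ := hcf.isCompact.measure_lt_top.ne
  have hbound : ∀ ε : ℝ, 0 < ε →
      ∫ x, ‖fderiv ℝ v x‖ ≤ (totalVariation v).toReal + ε * volume.real K := by
    intro ε hε
    have hpos : ∀ x, 0 < ‖X x‖ ^ 2 + ε ^ 2 := fun x => by positivity
    have hs : ContDiff ℝ 1 fun x => (Real.sqrt (‖X x‖ ^ 2 + ε ^ 2))⁻¹ :=
      (((hXc.norm_sq ℝ).add contDiff_const).sqrt fun x => (hpos x).ne').inv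
        fun x => (Real.sqrt_pos.2 (hpos x)).ne'
    have hle : ∀ x, ‖X x‖ ≤ Real.sqrt (‖X x‖ ^ 2 + ε ^ 2) := fun x =>
      Real.le_sqrt_of_sq_le (by nlinarith)
    have hle2 : ∀ x, Real.sqrt (‖X x‖ ^ 2 + ε ^ 2) ≤ ‖X x‖ + ε := fun x =>
      Real.sqrt_le_iff.2 ⟨by positivity, by nlinarith [norm_nonneg (X x)]⟩
    -- The optimal field `-∇v / |∇v|` is singular where the gradient vanishes; `ε` regularizes it.
    -- Its `C¹` regularity is what uses `v ∈ C²`.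
    have hφ : IsTestField fun x => -((Real.sqrt (‖X x‖ ^ 2 + ε ^ 2))⁻¹ • X x) :=
      { contDiff := (hs.smul hXc).neg
        hasCompactSupport := by
          refine HasCompactSupport.intro hcf fun x hx => ?_
          have : X x = 0 := by
            rw [← norm_eq_zero, hXn, image_eq_zero_of_notMem_tsupport hx, norm_zero]
          simp [this]
        norm_le_one := fun x => by
          have h0 := Real.sqrt_pos.2 (hpos x)
          rw [norm_neg, norm_smul, norm_inv, Real.norm_of_nonneg h0.le, inv_mul_le_iff₀ h0,
            mul_one]
          exact hle x }
    have h1 := hφ.integral_le_toReal_totalVariation htop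
    rw [integral_mul_divergence (hv.of_le (by norm_num)) hφ.contDiff hφ.hasCompactSupport,
      ← integral_neg] at h1
    -- Pointwise, `|X|² / √(|X|² + ε²) ≥ |X| - ε`. The loss is confined to the compact support `K`,
    -- which makes it integrable.
    have h2 : ∫ x, (‖fderiv ℝ v x‖ - K.indicator (fun _ => ε) x)
        ≤ ∫ x, -(fderiv ℝ v x) (-((Real.sqrt (‖X x‖ ^ 2 + ε ^ 2))⁻¹ • X x)) := by
      refine integral_mono (hint.sub ?_) ?_ fun x => ?_
      · exact (integrable_indicator_iff hcf.isCompact.measurableSet).2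
          (integrableOn_const hKf)
      · refine Continuous.integrable_of_hasCompactSupport ?_
          (HasCompactSupport.intro hcf fun x hx => ?_)
        · exact (hfd.continuous.clm_apply hφ.contDiff.continuous).neg
        · simp [image_eq_zero_of_notMem_tsupport hx]
      · by_cases hx : x ∈ K
        · have h0 := Real.sqrt_pos.2 (hpos x)
          simp only [hx, Set.indicator_of_mem, hXi, inner_neg_right, inner_smul_right,
            real_inner_self_eq_norm_sq, neg_neg, ← hXn]
          rw [inv_mul_eq_div, le_div_iff₀ h0]
          nlinarith [hle x, hle2 x, norm_nonneg (X x), Real.sq_sqrt (hpos x).le]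
        · simp [hx, image_eq_zero_of_notMem_tsupport hx]
    rw [integral_sub hint ((integrable_indicator_iff hcf.isCompact.measurableSet).2
      (integrableOn_const hKf)), integral_indicator_const _ hcf.isCompact.measurableSet,
      smul_eq_mul] at h2
    linarith [mul_comm (volume.real K) ε]
  have hfin : ∫ x, ‖fderiv ℝ v x‖ ≤ (totalVariation v).toReal := by
    have ht : Tendsto (fun ε : ℝ => (totalVariation v).toReal + ε * volume.real K) (𝓝[>] 0)
        (𝓝 ((totalVariation v).toReal + 0 * volume.real K)) :=
      (Continuous.tendsto (by fun_prop) 0).mono_left nhdsWithin_le_nhds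
    rw [zero_mul, add_zero] at ht
    exact ge_of_tendsto ht (eventually_mem_nhdsWithin.mono fun ε hε => hbound ε hε)
  rw [← ofReal_integral_norm_eq_lintegral_enorm
    (hfd.continuous.integrable_of_hasCompactSupport hcf)]
  exact (ENNReal.ofReal_le_iff_le_toReal htop).2 hfin

end TotalVariation

/-! ### The coarea inequality for smooth functions -/

section SmoothCoarea

variable {d : ℕ} {v : Eucl d → ℝ} {φ : Eucl d → Eucl d}

theorem integrable_comp_mul_norm_fderiv (hv : ContDiff ℝ 1 v) (hc : HasCompactSupport v)
    {ψ : ℝ → ℝ} (hψ : Continuous ψ) : Integrable fun x => ψ (v x) * ‖fderiv ℝ v x‖ := by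
  have hf := hv.continuous_fderiv one_ne_zero
  have := hv.continuous
  refine Continuous.integrable_of_hasCompactSupport (by fun_prop) ?_
  exact (hc.fderiv (𝕜 := ℝ)).norm.mul_left

/-- The chain rule gives `∇(G ∘ v) = ψ(v) ∇v` for the primitive `G` of `ψ`; integration by parts and
`|φ| ≤ 1` then give the bound. -/
theorem integral_primitive_comp_mul_divergence_le (hv : ContDiff ℝ 1 v)
    (hc : HasCompactSupport v) (hφ : IsTestField φ) {ψ : ℝ → ℝ} (hψ : Continuous ψ)
    (h0 : ∀ s, 0 ≤ ψ s) (a : ℝ) :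
    ∫ x, (∫ y in a..v x, ψ y) * divergence φ x ≤ ∫ x, ψ (v x) * ‖fderiv ℝ v x‖ := by
  have hd : ∀ s, HasDerivAt (fun s => ∫ y in a..s, ψ y) (ψ s) s := fun s =>
    intervalIntegral.integral_hasDerivAt_right (hψ.intervalIntegrable _ _)
      hψ.stronglyMeasurable.stronglyMeasurableAtFilter hψ.continuousAt
  have hG : ContDiff ℝ 1 (fun s => ∫ y in a..s, ψ y) := by
    rw [contDiff_one_iff_deriv]
    refine ⟨fun s => (hd s).differentiableAt, ?_⟩
    rwa [show deriv (fun s => ∫ y in a..s, ψ y) = ψ from funext fun s => (hd s).deriv]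
  have hfd : ∀ x, fderiv ℝ (fun x => ∫ y in a..v x, ψ y) x = ψ (v x) • fderiv ℝ v x := fun x =>
    ((hd (v x)).comp_hasFDerivAt x (hv.differentiable one_ne_zero x).hasFDerivAt).fderiv
  have hf := hv.continuous_fderiv one_ne_zero
  have hcv := hv.continuous
  have hcφ := hφ.contDiff.continuous
  have hibp := integral_mul_divergence (hG.comp hv) hφ.contDiff hφ.hasCompactSupport
  simp only [Function.comp_def, hfd] at hibp
  rw [hibp, ← integral_neg]
  refine integral_mono ?_ (integrable_comp_mul_norm_fderiv hv hc hψ) fun x => ?_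
  · refine Continuous.integrable_of_hasCompactSupport ?_
      (HasCompactSupport.intro hφ.hasCompactSupport fun x hx => ?_)
    · exact ((((hψ.comp hcv).smul hf)).clm_apply hcφ).neg
    · simp [image_eq_zero_of_notMem_tsupport hx]
  · simp only [smul_apply, smul_eq_mul, ← mul_neg]
    refine mul_le_mul_of_nonneg_left ?_ (h0 _)
    refine (neg_le_abs _).trans (((fderiv ℝ v x).le_opNorm _).trans ?_)
    exact mul_le_of_le_one_right (norm_nonneg _) (hφ.norm_le_one x)

/-- The ramp is only Lipschitz, so its slope, the indicator of `[a, b]`, is approximated by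
continuous thickened indicators, with dominated convergence on both sides. -/
theorem integral_ramp_comp_mul_divergence_le (hv : ContDiff ℝ 1 v)
    (hc : HasCompactSupport v) (hφ : IsTestField φ) (a b : ℝ) :
    ∫ x, (∫ y in a..v x, (Set.Icc a b).indicator (fun _ => (1 : ℝ)) y) * divergence φ x
      ≤ ∫ x, (Set.Icc a b).indicator (fun _ => (1 : ℝ)) (v x) * ‖fderiv ℝ v x‖ := by
  have hδ : ∀ n : ℕ, (0 : ℝ) < 1 / ((n : ℝ) + 1) := fun n => by positivity
  have hlim := thickenedIndicator_tendsto_indicator_closure hδ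
    tendsto_one_div_add_atTop_nhds_zero_nat (Set.Icc a b)
  rw [isClosed_Icc.closure_eq, tendsto_pi_nhds] at hlim
  set ψ : ℕ → ℝ → ℝ := fun n y => (thickenedIndicator (hδ n) (Set.Icc a b) y : ℝ) with hψdef
  have hψc : ∀ n, Continuous (ψ n) := fun n =>
    NNReal.continuous_coe.comp (thickenedIndicator (hδ n) (Set.Icc a b)).continuous
  have hψ0 : ∀ n s, 0 ≤ ψ n s := fun n s => NNReal.coe_nonneg _
  have hψ1 : ∀ n s, ψ n s ≤ 1 := fun n s =>
    NNReal.coe_le_one.2 (thickenedIndicator_le_one (hδ n) (Set.Icc a b) s)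
  have hψlim : ∀ s, Tendsto (fun n => ψ n s) atTop
      (𝓝 ((Set.Icc a b).indicator (fun _ => (1 : ℝ)) s)) := by
    intro s
    have := (NNReal.continuous_coe.tendsto _).comp (hlim s)
    rwa [show (((Set.Icc a b).indicator (fun _ => (1 : ℝ≥0)) s : ℝ≥0) : ℝ)
      = (Set.Icc a b).indicator (fun _ => (1 : ℝ)) s by
        by_cases hs : s ∈ Set.Icc a b <;> simp [hs]] at this
  have hcv := hv.continuous
  have hψn : ∀ n s, ‖ψ n s‖ ≤ 1 := fun n s => by
    rw [Real.norm_of_nonneg (hψ0 n s)]; exact hψ1 n s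
  refine le_of_tendsto_of_tendsto'
    (f := fun n => ∫ x, (∫ y in a..v x, ψ n y) * divergence φ x)
    (g := fun n => ∫ x, ψ n (v x) * ‖fderiv ℝ v x‖) (b := atTop) ?_ ?_
    fun n => integral_primitive_comp_mul_divergence_le hv hc hφ (hψc n) (hψ0 n) a
  · have hdc := continuous_divergence hφ.contDiff
    refine tendsto_integral_of_dominated_convergence
      (fun x => |v x - a| * ‖divergence φ x‖) (fun n => ?_) ?_ (fun n => ae_of_all _ fun x => ?_)
      (ae_of_all _ fun x => ?_)
    · have hp : Continuous fun s => ∫ y in a..s, ψ n y :=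
        intervalIntegral.continuous_primitive
          (fun _ _ => (hψc n).intervalIntegrable _ _) a
      exact ((hp.comp hcv).mul hdc).aestronglyMeasurable
    · exact Continuous.integrable_of_hasCompactSupport (by fun_prop)
        (hasCompactSupport_divergence hφ.hasCompactSupport).norm.mul_left
    · rw [norm_mul]
      refine mul_le_mul_of_nonneg_right ?_ (norm_nonneg _)
      simpa using intervalIntegral.norm_integral_le_of_norm_le_const
        (a := a) (b := v x) (C := 1) (f := ψ n) fun s _ => hψn n s
    · refine Tendsto.mul_const _ ?_
      exact intervalIntegral.tendsto_integral_filter_of_dominated_convergence (fun _ => 1)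
        (Eventually.of_forall fun n => (hψc n).aestronglyMeasurable)
        (Eventually.of_forall fun n => ae_of_all _ fun s _ => hψn n s)
        (intervalIntegrable_const) (ae_of_all _ fun s _ => hψlim s)
  · have hf := hv.continuous_fderiv one_ne_zero
    refine tendsto_integral_of_dominated_convergence (fun x => ‖fderiv ℝ v x‖) (fun n => ?_) ?_
      (fun n => ae_of_all _ fun x => ?_) (ae_of_all _ fun x => ?_)
    · exact (integrable_comp_mul_norm_fderiv hv hc (hψc n)).aestronglyMeasurable
    · simpa using integrable_comp_mul_norm_fderiv hv hc (continuous_const (y := (1 : ℝ)))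
    · rw [norm_mul, norm_norm]
      exact mul_le_of_le_one_left (norm_nonneg _) (hψn n _)
    · exact (hψlim _).mul_const _

theorem integral_indicator_Icc_left {a b s : ℝ} (hab : a ≤ b) :
    ∫ y in a..s, (Set.Icc a b).indicator (fun _ => (1 : ℝ)) y = max 0 (min (s - a) (b - a)) := by
  rcases le_total s a with h | h
  · rw [intervalIntegral.integral_symm, intervalIntegral.integral_of_le h,
      setIntegral_indicator measurableSet_Icc]
    have : Set.Ioc s a ∩ Set.Icc a b ⊆ {a} := fun y hy => le_antisymm hy.1.2 hy.2.1
    rw [setIntegral_measure_zero _ (measure_mono_null this (by simp)), neg_zero,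
      max_eq_left ((min_le_left _ _).trans (by linarith))]
  · rw [intervalIntegral.integral_of_le h, setIntegral_indicator measurableSet_Icc]
    have : Set.Ioc a s ∩ Set.Icc a b = Set.Ioc a (min s b) := by
      ext y; simp only [Set.mem_inter_iff, Set.mem_Ioc, Set.mem_Icc, le_min_iff]
      constructor
      · rintro ⟨⟨h1, h2⟩, h3, h4⟩; exact ⟨h1, h2, h4⟩
      · rintro ⟨h1, h2, h4⟩; exact ⟨⟨h1, h2⟩, h1.le, h4⟩
    rw [this]
    have h2 : a ≤ min s b := le_min h hab
    simp only [integral_const, smul_eq_mul, mul_one, MeasurableSet.univ, measureReal_restrict_apply,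
      Set.univ_inter, Real.volume_real_Ioc_of_le h2]
    rw [min_sub_sub_right, max_eq_right (by linarith)]

/-- The perimeters of the superlevel sets of a smooth function are bounded by a density whose
integral is at most the total variation. -/
theorem exists_density_of_contDiff (hv : ContDiff ℝ 2 v) (hc : HasCompactSupport v) :
    ∃ g : ℝ → ℝ≥0∞, Measurable g ∧ (∀ᵐ t, perimeter {x | t < v x} ≤ g t) ∧
      ∫⁻ t, g t ≤ totalVariation v := by
  have hv1 : ContDiff ℝ 1 v := hv.of_le (by norm_num)
  have hcv := hv1.continuous
  have hf := hv1.continuous_fderiv one_ne_zero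
  have hint : Integrable (fderiv ℝ v) :=
    hf.integrable_of_hasCompactSupport (hc.fderiv (𝕜 := ℝ))
  set ν : Measure (Eucl d) := volume.withDensity fun x => ‖fderiv ℝ v x‖ₑ with hν
  have hνf : IsFiniteMeasure ν := isFiniteMeasure_withDensity hint.2.ne
  set μ : Measure ℝ := ν.map v with hμ
  -- `μ` is the image under `v` of the measure `|∇v| dx`. Its singular part can be discarded, since
  -- only an upper bound on the integral of the density is required.
  refine ⟨μ.rnDeriv volume, Measure.measurable_rnDeriv _ _, ?_, ?_⟩
  -- Only countably many levels have positive measure. At the others, the ramps converge almost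
  -- everywhere to the indicator of `{v > t}`.
  · have hcount : ∀ᵐ t : ℝ, volume {x | v x = t} = 0 := by
      have := (Measure.countable_meas_level_set_pos (μ := (volume : Measure (Eucl d)))
        hcv.measurable).ae_notMem (volume : Measure ℝ)
      filter_upwards [this] with t ht
      simpa using ht
    filter_upwards [hcount, Besicovitch.ae_tendsto_rnDeriv μ volume] with t ht hlim
    refine iSup₂_le fun φ hφ => ?_
    have hdc := continuous_divergence hφ.contDiff
    -- The ramp rises from `0` to `1` on `[t - h, t + h]`. Testing it against `φ` is bounded by
    -- `μ(B(t, h)) / |B(t, h)|`, whose limit is the density at almost every `t`.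
    set ramp : ℝ → ℝ → ℝ := fun h s =>
      (2 * h)⁻¹ * ∫ y in (t - h)..s, (Set.Icc (t - h) (t + h)).indicator (fun _ => (1 : ℝ)) y
    have hramp : ∀ h, 0 < h → ∀ s, ramp h s = (2 * h)⁻¹ * max 0 (min (s - (t - h)) (2 * h)) := by
      intro h hh s
      simp only [ramp]
      rw [integral_indicator_Icc_left (by linarith)]
      ring_nf
    have hlim2 : Tendsto (fun h => ENNReal.ofReal (∫ x, ramp h (v x) * divergence φ x)) (𝓝[>] 0)
        (𝓝 (ENNReal.ofReal
          (∫ x, ({x | t < v x}.indicator (fun _ => (1 : ℝ)) x) * divergence φ x))) := by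
      refine (ENNReal.continuous_ofReal.tendsto _).comp ?_
      refine tendsto_integral_filter_of_dominated_convergence (fun x => ‖divergence φ x‖)
        ?_ ?_ hφ.integrable_divergence.norm ?_
      · filter_upwards [self_mem_nhdsWithin] with h hh
        simp only [hramp h hh]
        exact Continuous.aestronglyMeasurable (by fun_prop)
      · filter_upwards [self_mem_nhdsWithin] with h hh
        refine ae_of_all _ fun x => ?_
        have hh' : (0 : ℝ) < 2 * h := by simpa using hh
        rw [norm_mul, hramp h hh]
        refine mul_le_of_le_one_left (norm_nonneg _) ?_
        rw [Real.norm_of_nonneg (by positivity), inv_mul_le_iff₀ hh', mul_one]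
        exact max_le hh'.le (min_le_right _ _)
      · have hne : ∀ᵐ x, v x ≠ t := by
          rw [ae_iff]; simpa using ht
        filter_upwards [hne] with x hx
        refine Tendsto.mul_const _ (tendsto_const_nhds.congr' ?_)
        rcases lt_or_gt_of_ne hx with hlt | hgt
        · filter_upwards [Ioc_mem_nhdsGT (sub_pos.2 hlt)] with h hh
          rw [hramp h hh.1, max_eq_left ((min_le_left _ _).trans (by linarith [hh.2])), mul_zero]
          simp [not_lt.2 hlt.le]
        · filter_upwards [Ioc_mem_nhdsGT (sub_pos.2 hgt)] with h hh
          have hh' : (0 : ℝ) < 2 * h := by linarith [hh.1]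
          rw [hramp h hh.1, min_eq_right (by linarith [hh.2]), max_eq_right hh'.le,
            inv_mul_cancel₀ hh'.ne']
          simp [hgt]
    refine le_of_tendsto_of_tendsto hlim2 hlim ?_
    filter_upwards [self_mem_nhdsWithin] with h hh
    have hh' : (0 : ℝ) < 2 * h := by simpa using hh
    have hmeas : MeasurableSet (v ⁻¹' Metric.closedBall t h) :=
      hcv.measurable Metric.isClosed_closedBall.measurableSet
    have hball : μ (Metric.closedBall t h)
        = ENNReal.ofReal (∫ x, (Set.Icc (t - h) (t + h)).indicator (fun _ => (1 : ℝ)) (v x)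
            * ‖fderiv ℝ v x‖) := by
      rw [hμ, Measure.map_apply hcv.measurable Metric.isClosed_closedBall.measurableSet, hν,
        withDensity_apply _ hmeas, ← ofReal_integral_norm_eq_lintegral_enorm hint.integrableOn,
        ← integral_indicator hmeas]
      congr 2 with x
      by_cases hx : v x ∈ Metric.closedBall t h
      · have hx' := hx
        rw [Real.closedBall_eq_Icc] at hx'
        simp [hx', Set.indicator, hx]
      · have hx' := hx
        rw [Real.closedBall_eq_Icc] at hx'
        rw [Set.indicator_of_notMem hx', Set.indicator_of_notMem (by exact hx), zero_mul]
    rw [hball, Real.volume_closedBall, ← ENNReal.ofReal_div_of_pos hh']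
    refine ENNReal.ofReal_le_ofReal ?_
    simp only [ramp, mul_assoc]
    rw [integral_const_mul, inv_mul_eq_div]
    exact div_le_div_of_nonneg_right
      (integral_ramp_comp_mul_divergence_le hv1 hc hφ (t - h) (t + h)) hh'.le
  · refine Measure.lintegral_rnDeriv_le.trans ?_
    rw [hμ, Measure.map_apply hcv.measurable MeasurableSet.univ, Set.preimage_univ, hν,
      withDensity_apply _ MeasurableSet.univ, Measure.restrict_univ]
    exact lintegral_enorm_fderiv_le hv hc

end SmoothCoarea

/-! ### The coarea formula -/

section Coarea

variable {d : ℕ} {u : Eucl d → ℝ}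

/-- Averaging by convolution does not increase the total variation. -/
theorem totalVariation_convolution_le {ρ : Eucl d → ℝ} (hρ : Integrable ρ) (h0 : ∀ z, 0 ≤ ρ z)
    (h1 : ∫ z, ρ z = 1) (hu : Integrable u) :
    totalVariation (convolution ρ u (ContinuousLinearMap.lsmul ℝ ℝ) volume)
      ≤ totalVariation u := by
  rcases eq_or_ne (totalVariation u) ∞ with htop | htop
  · simp [htop]
  refine iSup₂_le fun φ hφ => (ENNReal.ofReal_le_iff_le_toReal htop).2 ?_
  obtain ⟨C, hC⟩ := hφ.exists_abs_divergence_le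
  have hdc := continuous_divergence hφ.contDiff
  have hF : Integrable (Function.uncurry fun x z => ρ z * u (x - z) * divergence φ x)
      ((volume : Measure (Eucl d)).prod volume) := by
    have := hρ.convolution_integrand (ContinuousLinearMap.lsmul ℝ ℝ) (μ := volume) hu
    exact this.mul_bdd (hdc.comp continuous_fst).aestronglyMeasurable
      (ae_of_all _ fun p => by simpa using hC p.1)
  have hin : ∀ z, ∫ x, ρ z * u (x - z) * divergence φ x ≤ ρ z * (totalVariation u).toReal := by
    intro z
    simp only [mul_assoc]
    rw [integral_const_mul]
    refine mul_le_mul_of_nonneg_left ?_ (h0 z)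
    -- The translation is moved from `u` to the test field, where admissibility is preserved.
    rw [← integral_add_right_eq_self _ z]
    simp only [add_sub_cancel_right, ← divergence_comp_add_right]
    exact (hφ.comp_add_right z).integral_le_toReal_totalVariation htop
  calc ∫ x, convolution ρ u (ContinuousLinearMap.lsmul ℝ ℝ) volume x * divergence φ x
      = ∫ x, ∫ z, ρ z * u (x - z) * divergence φ x := by
        simp only [convolution_def, ContinuousLinearMap.lsmul_apply, smul_eq_mul,
          integral_mul_const]
    _ = ∫ z, ∫ x, ρ z * u (x - z) * divergence φ x := integral_integral_swap hF
    _ ≤ ∫ z, ρ z * (totalVariation u).toReal :=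
        integral_mono hF.integral_prod_right (hρ.mul_const _) hin
    _ = (totalVariation u).toReal := by rw [integral_mul_const, h1, one_mul]

/-- Lower semicontinuity of the perimeter of superlevel sets under pointwise convergence. -/
theorem perimeter_superlevel_le_liminf {w : ℕ → Eucl d → ℝ} (hw : ∀ n, Measurable (w n))
    (hlim : ∀ᵐ x, Tendsto (fun n => w n x) atTop (𝓝 (u x))) {t : ℝ} (ht : ∀ᵐ x, u x ≠ t) :
    perimeter {x | t < u x} ≤ liminf (fun n => perimeter {x | t < w n x}) atTop := by
  refine iSup₂_le fun φ hφ => ?_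
  have hT : Tendsto (fun n => ENNReal.ofReal
      (∫ x, ({x | t < w n x}.indicator (fun _ => (1 : ℝ)) x) * divergence φ x)) atTop
      (𝓝 (ENNReal.ofReal
        (∫ x, ({x | t < u x}.indicator (fun _ => (1 : ℝ)) x) * divergence φ x))) := by
    refine (ENNReal.continuous_ofReal.tendsto _).comp ?_
    have hdc := continuous_divergence hφ.contDiff
    refine tendsto_integral_of_dominated_convergence (fun x => ‖divergence φ x‖)
      (fun n => ?_) hφ.integrable_divergence.norm (fun n => ae_of_all _ fun x => ?_) ?_
    · exact ((measurable_const.indicator (measurableSet_lt measurable_const (hw n))).mul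
        hdc.measurable).aestronglyMeasurable
    · rw [norm_mul]
      refine mul_le_of_le_one_left (norm_nonneg _) ?_
      by_cases hx : t < w n x <;> simp [hx]
    · filter_upwards [hlim, ht] with x hx hxt
      refine Tendsto.mul_const _ (tendsto_const_nhds.congr' ?_)
      rcases lt_or_gt_of_ne hxt with hlt | hgt
      · filter_upwards [hx.eventually (gt_mem_nhds hlt)] with n hn
        simp [not_lt.2 hlt.le, not_lt.2 hn.le]
      · filter_upwards [hx.eventually (lt_mem_nhds hgt)] with n hn
        simp [hgt, hn]
  rw [← hT.liminf_eq]
  exact liminf_le_liminf (Eventually.of_forall fun n => hφ.le_totalVariation _)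

/-- Half of the coarea formula: the perimeters of the superlevel sets are bounded by a measurable
function whose integral is at most the total variation. -/
theorem exists_density_of_integrable (hu : Integrable u) (hc : HasCompactSupport u) :
    ∃ g : ℝ → ℝ≥0∞, Measurable g ∧ (∀ᵐ t, perimeter {x | t < u x} ≤ g t) ∧
      ∫⁻ t, g t ≤ totalVariation u := by
  let b : ℕ → ContDiffBump (0 : Eucl d) := fun n =>
    { rIn := 1 / ((n : ℝ) + 1)
      rOut := 2 * (1 / ((n : ℝ) + 1))
      rIn_pos := by positivity
      rIn_lt_rOut := by
        have : (0 : ℝ) < 1 / ((n : ℝ) + 1) := by positivity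
        linarith }
  have hb : Tendsto (fun n => (b n).rOut) atTop (𝓝 0) := by
    have := (tendsto_one_div_add_atTop_nhds_zero_nat (𝕜 := ℝ)).const_mul 2
    rwa [mul_zero] at this
  set w : ℕ → Eucl d → ℝ := fun n =>
    convolution ((b n).normed volume) u (ContinuousLinearMap.lsmul ℝ ℝ) volume with hw
  have hlim : ∀ᵐ x, Tendsto (fun n => w n x) atTop (𝓝 (u x)) :=
    ContDiffBump.ae_convolution_tendsto_right_of_locallyIntegrable (K := 2) hb
      (Eventually.of_forall fun n => le_rfl) hu.locallyIntegrable
  have hws : ∀ n, ContDiff ℝ 2 (w n) := fun n =>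
    (b n).hasCompactSupport_normed.contDiff_convolution_left (n := 2) _
      (b n).contDiff_normed hu.locallyIntegrable
  have hwc : ∀ n, HasCompactSupport (w n) := fun n =>
    (b n).hasCompactSupport_normed.convolution _ hc
  have hwt : ∀ n, totalVariation (w n) ≤ totalVariation u := fun n =>
    totalVariation_convolution_le (b n).integrable_normed (b n).nonneg_normed
      (b n).integral_normed hu
  choose g hgm hgp hgi using fun n => exists_density_of_contDiff (hws n) (hwc n)
  -- Lower semicontinuity of the perimeter shows that this bounds the perimeters; Fatou's lemma
  -- bounds its integral.
  refine ⟨fun t => liminf (fun n => g n t) atTop, Measurable.liminf hgm, ?_, ?_⟩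
  · have hcount : ∀ᵐ t : ℝ, ∀ᵐ x, u x ≠ t := by
      have := (Measure.countable_meas_level_set_pos₀ (μ := (volume : Measure (Eucl d)))
        hu.aestronglyMeasurable.aemeasurable.nullMeasurable).ae_notMem (volume : Measure ℝ)
      filter_upwards [this] with t ht
      rw [ae_iff]
      simpa using ht
    filter_upwards [hcount, ae_all_iff.2 hgp] with t ht hgt
    exact (perimeter_superlevel_le_liminf (fun n => (hws n).continuous.measurable) hlim ht).trans
      (liminf_le_liminf (Eventually.of_forall hgt))
  · refine (lintegral_liminf_le hgm).trans ?_
    refine (liminf_le_liminf (Eventually.of_forall fun n => (hgi n).trans (hwt n))).trans ?_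
    simp

/-- Half of the coarea formula: the total variation is at most the integral of the perimeters of
the superlevel sets. -/
theorem totalVariation_le_lintegral_perimeter (hu : Integrable u) (h0 : ∀ᵐ x, 0 ≤ u x) :
    totalVariation u ≤ ∫⁻ t in Set.Ioi (0 : ℝ), perimeter {x | t < u x} := by
  refine iSup₂_le fun φ hφ => ?_
  have hdm := (continuous_divergence hφ.contDiff).measurable
  have hae := hu.aestronglyMeasurable.aemeasurable
  set p : Eucl d → ℝ≥0∞ := fun x => ENNReal.ofReal (divergence φ x)
  set q : Eucl d → ℝ≥0∞ := fun x => ENNReal.ofReal (-divergence φ x)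
  have hp : Measurable p := hdm.ennreal_ofReal
  have hq : Measurable q := hdm.neg.ennreal_ofReal
  have hlevel : ∀ t, NullMeasurableSet {x | t < u x} := fun t =>
    nullMeasurableSet_lt aemeasurable_const hae
  -- Layer cake formula for the measure `r dx`. It is applied separately to the positive and
  -- negative parts of the divergence.
  have hcake : ∀ {r : Eucl d → ℝ≥0∞}, Measurable r →
      ∫⁻ x, r x * ENNReal.ofReal (u x) = ∫⁻ t in Set.Ioi (0 : ℝ), ∫⁻ x in {x | t < u x}, r x := by
    intro r hr
    have hac : volume.withDensity r ≪ (volume : Measure (Eucl d)) :=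
      withDensity_absolutelyContinuous _ _
    have := lintegral_eq_lintegral_meas_lt (volume.withDensity r) (hac.ae_le h0) (hae.mono_ac hac)
    rw [lintegral_withDensity_eq_lintegral_mul₀ hr.aemeasurable hae.ennreal_ofReal] at this
    simp only [Pi.mul_apply] at this
    rw [this]
    refine lintegral_congr fun t => ?_
    exact withDensity_apply₀ _ (hlevel t)
  have hI := hφ.integrable_divergence
  -- The additive form avoids subtraction in `ℝ≥0∞`, and only the `q` term has to be measurable in
  -- `t` to split the integral.
  have hstep : ∀ t, ∫⁻ x in {x | t < u x}, p x
      ≤ (∫⁻ x in {x | t < u x}, q x) + perimeter {x | t < u x} := by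
    intro t
    have h1 := hφ.le_perimeter (hlevel t)
    rw [integral_eq_lintegral_pos_part_sub_lintegral_neg_part hI.integrableOn] at h1
    have hqf : ∫⁻ x in {x | t < u x}, q x ≠ ∞ := hI.integrableOn.neg.lintegral_lt_top.ne
    have hpf : ∫⁻ x in {x | t < u x}, p x ≠ ∞ := hI.integrableOn.lintegral_lt_top.ne
    rw [ENNReal.ofReal_sub _ ENNReal.toReal_nonneg, ENNReal.ofReal_toReal hpf,
      ENNReal.ofReal_toReal hqf] at h1
    exact tsub_le_iff_left.1 h1
  have hmono : Measurable fun t : ℝ => ∫⁻ x in {x | t < u x}, q x :=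
    Antitone.measurable fun s t hst =>
      lintegral_mono_set fun x (hx : t < u x) => lt_of_le_of_lt hst hx
  have hsum : ∫⁻ x, p x * ENNReal.ofReal (u x) ≤ (∫⁻ x, q x * ENNReal.ofReal (u x))
      + ∫⁻ t in Set.Ioi (0 : ℝ), perimeter {x | t < u x} := by
    rw [hcake hp, hcake hq, ← lintegral_add_left hmono]
    exact lintegral_mono fun t => hstep t
  have hpu : ∀ᵐ x, ENNReal.ofReal (u x * divergence φ x) = p x * ENNReal.ofReal (u x) := by
    filter_upwards [h0] with x hx
    rw [ENNReal.ofReal_mul hx, mul_comm]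
  have hqu : ∀ᵐ x, ENNReal.ofReal (-(u x * divergence φ x)) = q x * ENNReal.ofReal (u x) := by
    filter_upwards [h0] with x hx
    rw [← mul_neg, ENNReal.ofReal_mul hx, mul_comm]
  have hIu := hφ.integrable_mul_divergence hu
  have hneg : ∫⁻ x, ENNReal.ofReal (-(u x * divergence φ x)) ≠ ∞ := hIu.neg.lintegral_lt_top.ne
  rw [integral_eq_lintegral_pos_part_sub_lintegral_neg_part hIu,
    ENNReal.ofReal_sub _ ENNReal.toReal_nonneg, ENNReal.ofReal_toReal hIu.lintegral_lt_top.ne,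
    ENNReal.ofReal_toReal hneg, lintegral_congr_ae hpu,
    lintegral_congr_ae hqu]
  exact tsub_le_iff_left.2 hsum

end Coarea

/-! ### Superlevel sets of a function with unit `L¹` norm -/

section Superlevel

variable {d : ℕ} {Ω : Set (Eucl d)} {u : Eucl d → ℝ}

/-- Truncation to the bounded set `Ω` changes `u` only on a null set and provides the compact
support needed for the coarea inequality. -/
theorem MemBVZero.exists_density (hbdd : Bornology.IsBounded Ω) (hΩ : MeasurableSet Ω)
    (hu : MemBVZero Ω u) :
    ∃ g : ℝ → ℝ≥0∞, Measurable g ∧ (∀ᵐ t, perimeter {x | t < u x} ≤ g t) ∧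
      ∫⁻ t, g t ≤ totalVariation u := by
  have hae : u =ᵐ[volume] Ω.indicator u := by
    filter_upwards [hu.ae_eq_zero] with x hx
    by_cases h : x ∈ Ω
    · rw [Set.indicator_of_mem h]
    · rw [Set.indicator_of_notMem h, hx h]
  have hc : HasCompactSupport (Ω.indicator u) :=
    HasCompactSupport.of_support_subset_isCompact hbdd.isCompact_closure
      (Set.support_indicator_subset.trans subset_closure)
  obtain ⟨g, hg, hgp, hgi⟩ := exists_density_of_integrable (hu.integrable.indicator hΩ) hc
  refine ⟨g, hg, ?_, by rwa [totalVariation_congr_ae hae]⟩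
  filter_upwards [hgp] with t ht
  refine le_trans (le_of_eq (perimeter_congr_ae ?_)) ht
  filter_upwards [hae] with x hx
  change (t < u x) = (t < Ω.indicator u x)
  rw [hx]

theorem MemBVZero.nullMeasurableSet_superlevel (hu : MemBVZero Ω u) (t : ℝ) :
    NullMeasurableSet {x | t < u x} :=
  nullMeasurableSet_lt aemeasurable_const hu.integrable.aestronglyMeasurable.aemeasurable

theorem MemBVZero.volume_superlevel_diff (hu : MemBVZero Ω u) {t : ℝ} (ht : 0 < t) :
    volume ({x | t < u x} \ Ω) = 0 := by
  refine measure_mono_null (fun x hx => ?_) (ae_iff.1 hu.ae_eq_zero)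
  intro h
  have h1 : t < u x := hx.1
  rw [h hx.2] at h1
  exact lt_asymm h1 ht

theorem volume_lt_top_of_diff_null (hbdd : Bornology.IsBounded Ω) {E : Set (Eucl d)}
    (hE : volume (E \ Ω) = 0) : volume E < ∞ := by
  refine (measure_le_inter_add_sdiff volume E Ω).trans_lt ?_
  rw [hE, add_zero]
  exact (measure_mono Set.inter_subset_right).trans_lt hbdd.measure_lt_top

theorem perimeter_of_volume_eq_zero {E : Set (Eucl d)} (hE : volume E = 0) :
    perimeter E = 0 := by
  rw [perimeter_congr_ae (ae_eq_empty.2 hE)]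
  simp [perimeter, totalVariation]

theorem lintegral_volume_superlevel (hu : AEMeasurable u) (h0 : ∀ᵐ x, 0 ≤ u x)
    (h1 : ∫ x, |u x| = 1) : ∫⁻ t in Set.Ioi (0 : ℝ), volume {x | t < u x} = 1 := by
  rw [← lintegral_eq_lintegral_meas_lt volume h0 hu]
  have h2 : ∫ x, u x = 1 := by
    rw [← h1]
    exact integral_congr_ae (h0.mono fun x hx => (abs_of_nonneg hx).symm)
  have h3 : Integrable u := by
    by_contra h
    rw [integral_undef h] at h2
    exact zero_ne_one h2
  rw [← ofReal_integral_eq_lintegral_ofReal h3 h0, h2, ENNReal.ofReal_one]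

theorem measurable_volume_superlevel : Measurable fun t : ℝ => volume {x | t < u x} :=
  Antitone.measurable fun _ _ hst => measure_mono fun _ hx => lt_of_le_of_lt hst hx

theorem lintegral_const_mul_volume_superlevel (hu : AEMeasurable u) (h0 : ∀ᵐ x, 0 ≤ u x)
    (h1 : ∫ x, |u x| = 1) (c : ℝ≥0∞) :
    ∫⁻ t in Set.Ioi (0 : ℝ), c * volume {x | t < u x} = c := by
  rw [lintegral_const_mul _ measurable_volume_superlevel, lintegral_volume_superlevel hu h0 h1,
    mul_one]

theorem not_ae_volume_superlevel_eq_zero (hu : AEMeasurable u) (h0 : ∀ᵐ x, 0 ≤ u x)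
    (h1 : ∫ x, |u x| = 1) :
    ¬ ∀ᵐ t ∂volume.restrict (Set.Ioi (0 : ℝ)), volume {x | t < u x} = 0 := by
  intro h
  have := lintegral_volume_superlevel hu h0 h1
  rw [lintegral_congr_ae h, lintegral_zero] at this
  exact zero_ne_one this

/-- If no superlevel set has a smaller isoperimetric ratio than the total variation, then almost
all of them attain it. -/
theorem MemBVZero.ae_perimeter_superlevel_eq (hbdd : Bornology.IsBounded Ω)
    (hΩ : MeasurableSet Ω) (hu : MemBVZero Ω u) (h0 : ∀ᵐ x, 0 ≤ u x) (h1 : ∫ x, |u x| = 1)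
    (hle : ∀ t, 0 < t → totalVariation u * volume {x | t < u x} ≤ perimeter {x | t < u x}) :
    ∀ᵐ t, 0 < t → perimeter {x | t < u x} = totalVariation u * volume {x | t < u x} := by
  obtain ⟨g, hg, hgp, hgi⟩ := hu.exists_density hbdd hΩ
  have hI := lintegral_const_mul_volume_superlevel
    hu.integrable.aestronglyMeasurable.aemeasurable h0 h1 (totalVariation u)
  have hfg : ∀ᵐ t ∂volume.restrict (Set.Ioi (0 : ℝ)),
      totalVariation u * volume {x | t < u x} ≤ g t := by
    filter_upwards [ae_restrict_of_ae hgp, ae_restrict_mem measurableSet_Ioi] with t ht ht0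
    exact (hle t ht0).trans ht
  -- Both sides of `|Du| |{u > t}| ≤ g t` have the same finite integral, so they agree almost
  -- everywhere and squeeze the perimeter between them.
  have heq := ae_eq_of_ae_le_of_lintegral_le hfg
    (by rw [hI]; exact hu.totalVariation_lt_top.ne) hg.aemeasurable
    (by rw [hI]; exact (setLIntegral_le_lintegral _ _).trans hgi)
  rw [EventuallyEq, ae_restrict_iff' measurableSet_Ioi] at heq
  filter_upwards [heq, hgp] with t ht htg ht0
  exact le_antisymm (by rw [ht ht0]; exact htg) (hle t ht0)

/-- Some superlevel set has isoperimetric ratio at most the total variation. -/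
theorem MemBVZero.exists_perimeter_superlevel_le (hbdd : Bornology.IsBounded Ω)
    (hΩ : MeasurableSet Ω) (hu : MemBVZero Ω u) (h0 : ∀ᵐ x, 0 ≤ u x) (h1 : ∫ x, |u x| = 1) :
    ∃ t, 0 < t ∧ 0 < volume {x | t < u x} ∧
      perimeter {x | t < u x} ≤ totalVariation u * volume {x | t < u x} := by
  by_contra! h
  -- If every non-null superlevel set had a ratio above `|Du|`, equality almost everywhere would
  -- leave only null ones, against the unit mass of `u`.
  have := hu.ae_perimeter_superlevel_eq hbdd hΩ h0 h1 fun t ht => by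
    rcases eq_or_ne (volume {x | t < u x}) 0 with hm | hm
    · simp [hm]
    · exact (h t ht (pos_iff_ne_zero.2 hm)).le
  refine not_ae_volume_superlevel_eq_zero
    hu.integrable.aestronglyMeasurable.aemeasurable h0 h1 ?_
  rw [ae_restrict_iff' measurableSet_Ioi]
  filter_upwards [this] with t ht ht0
  by_contra hm
  exact (h t ht0 (pos_iff_ne_zero.2 hm)).ne' (ht ht0)

/-- The superlevel sets with isoperimetric ratio at least the total variation are not
negligible. -/
theorem MemBVZero.volume_setOf_le_perimeter_superlevel_ne_zero (hu : MemBVZero Ω u)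
    (h0 : ∀ᵐ x, 0 ≤ u x) (h1 : ∫ x, |u x| = 1) :
    volume {t : ℝ | 0 < t ∧ 0 < volume {x | t < u x} ∧
      totalVariation u * volume {x | t < u x} ≤ perimeter {x | t < u x}} ≠ 0 := by
  intro hnull
  have hmeas := hu.integrable.aestronglyMeasurable.aemeasurable
  have hlt : ∀ᵐ t ∂volume.restrict (Set.Ioi (0 : ℝ)), 0 < volume {x | t < u x} →
      perimeter {x | t < u x} < totalVariation u * volume {x | t < u x} := by
    rw [ae_restrict_iff' measurableSet_Ioi]
    filter_upwards [compl_mem_ae_iff.2 hnull] with t ht ht0 hm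
    by_contra! hle
    exact ht ⟨ht0, hm, hle⟩
  have hI := lintegral_const_mul_volume_superlevel hmeas h0 h1 (totalVariation u)
  have hle : ∀ᵐ t ∂volume.restrict (Set.Ioi (0 : ℝ)),
      perimeter {x | t < u x} ≤ totalVariation u * volume {x | t < u x} := by
    filter_upwards [hlt] with t ht
    rcases eq_or_ne (volume {x | t < u x}) 0 with hm | hm
    · rw [perimeter_of_volume_eq_zero hm]; exact zero_le
    · exact (ht (pos_iff_ne_zero.2 hm)).le
  -- Here the known measurable side is the volume term, and the integral comparison is the other
  -- half of coarea.
  have heq := ae_eq_of_ae_le_of_lintegral_le hle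
    (((lintegral_mono_ae hle).trans_eq hI).trans_lt hu.totalVariation_lt_top).ne
    (measurable_volume_superlevel.const_mul _).aemeasurable
    (hI.le.trans (totalVariation_le_lintegral_perimeter hu.integrable h0))
  refine not_ae_volume_superlevel_eq_zero hmeas h0 h1 ?_
  filter_upwards [heq, hlt] with t ht htl
  by_contra hm
  exact (htl (pos_iff_ne_zero.2 hm)).ne ht

/-- The normalized characteristic function of a set of finite perimeter. -/
theorem memBVZero_indicator (hbdd : Bornology.IsBounded Ω) {E : Set (Eucl d)}
    (hE : NullMeasurableSet E) (hsub : volume (E \ Ω) = 0) (hper : perimeter E < ∞) :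
    MemBVZero Ω (E.indicator fun _ => (volume E).toReal⁻¹) where
  integrable :=
    (integrableOn_const (volume_lt_top_of_diff_null hbdd hsub).ne).integrable_indicator₀ hE
  totalVariation_lt_top := by
    have : (E.indicator fun _ => (volume E).toReal⁻¹)
        = fun x => (volume E).toReal⁻¹ * E.indicator (fun _ => (1 : ℝ)) x := by
      ext x; by_cases hx : x ∈ E <;> simp [hx]
    rw [this, totalVariation_const_mul (by positivity)]
    exact ENNReal.mul_lt_top ENNReal.ofReal_lt_top hper
  ae_eq_zero := by
    filter_upwards [compl_mem_ae_iff.2 hsub] with x hx hxΩ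
    exact Set.indicator_of_notMem (fun h => hx ⟨h, hxΩ⟩) _

theorem totalVariation_indicator {E : Set (Eucl d)} (h0 : 0 < volume E) (hE : volume E < ∞) :
    totalVariation (E.indicator fun _ => (volume E).toReal⁻¹) = perimeter E / volume E := by
  have : (E.indicator fun _ => (volume E).toReal⁻¹)
      = fun x => (volume E).toReal⁻¹ * E.indicator (fun _ => (1 : ℝ)) x := by
    ext x; by_cases hx : x ∈ E <;> simp [hx]
  rw [this, totalVariation_const_mul (by positivity),
    ENNReal.ofReal_inv_of_pos (ENNReal.toReal_pos h0.ne' hE.ne), ENNReal.ofReal_toReal hE.ne,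
    mul_comm, div_eq_mul_inv]
  rfl

theorem integral_abs_indicator {E : Set (Eucl d)} (hE : NullMeasurableSet E)
    (h0 : 0 < volume E) (hfin : volume E < ∞) :
    ∫ x, |E.indicator (fun _ => (volume E).toReal⁻¹) x| = 1 := by
  have : ∀ x, |E.indicator (fun _ => (volume E).toReal⁻¹) x|
      = E.indicator (fun _ => (volume E).toReal⁻¹) x := fun x =>
    abs_of_nonneg (Set.indicator_nonneg (fun _ _ => by positivity) x)
  simp only [this]
  rw [integral_indicator₀ hE, setIntegral_const, smul_eq_mul, measureReal_def,
    mul_inv_cancel₀ (ENNReal.toReal_pos h0.ne' hfin.ne).ne']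

end Superlevel

/-! ### Clusters and `(1, N)`-functions -/

section Clusters

variable {d N : ℕ} {Ω : Set (Eucl d)} {Φ : (Fin N → ℝ≥0) → ℝ≥0}
  {u : Fin N → Eucl d → ℝ} {E : Fin N → Set (Eucl d)}

theorem cheegerH_le (hE : IsNCluster Ω E) : cheegerH Φ Ω ≤ Φ (ratio E) :=
  iInf₂_le (f := fun (E : Fin N → Set (Eucl d)) (_ : IsNCluster Ω E) => (Φ (ratio E) : ℝ≥0∞)) E hE

theorem cheeger_le {F G : Set (Eucl d)} (hG : NullMeasurableSet G) (hsub : volume (G \ F) = 0)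
    (hpos : 0 < volume G) : cheeger F ≤ perimeter G / volume G :=
  iInf_le_of_le G (iInf_le_of_le ⟨hG, hsub, hpos⟩ le_rfl)

theorem functionalEigenvalue_le (hu : IsOneNFunction Ω u) :
    functionalEigenvalue Φ Ω ≤ Φ (variationVector u) :=
  iInf₂_le (f := fun (u : Fin N → Eucl d → ℝ) (_ : IsOneNFunction Ω u) =>
    (Φ (variationVector u) : ℝ≥0∞)) u hu

theorem apply_update_lt_of_strictMono (hΦ : StrictMono Φ) {x : Fin N → ℝ≥0} {i : Fin N} {a : ℝ≥0}
    (ha : a < x i) : Φ (Function.update x i a) < Φ x :=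
  hΦ (update_lt_self_iff.2 ha)

theorem toNNReal_div_lt {a b c : ℝ≥0∞} (h : a / b < c) (hc : c ≠ ∞) :
    (a / b).toNNReal < c.toNNReal :=
  (ENNReal.toNNReal_lt_toNNReal h.ne_top hc).2 h

theorem IsNCluster.div_ne_top (hE : IsNCluster Ω E) (i : Fin N) :
    perimeter (E i) / volume (E i) ≠ ∞ :=
  ENNReal.div_ne_top (hE.perimeter_lt_top i).ne (hE.volume_pos i).ne'

theorem IsNCluster.isOneNFunction (hbdd : Bornology.IsBounded Ω) (hE : IsNCluster Ω E) :
    IsOneNFunction Ω (clusterFunction E) where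
  memBVZero i := memBVZero_indicator hbdd (hE.nullMeasurableSet i) (hE.subset i)
    (hE.perimeter_lt_top i)
  nonneg i := ae_of_all _ fun x => Set.indicator_nonneg (fun _ _ => by positivity) x
  norm_eq_one i := integral_abs_indicator (hE.nullMeasurableSet i) (hE.volume_pos i)
    (volume_lt_top_of_diff_null hbdd (hE.subset i))
  mul_eq_zero i j hij := by
    filter_upwards [compl_mem_ae_iff.2 (hE.disjoint i j hij)] with x hx _
    by_cases hi : x ∈ E i
    · have hj : x ∉ E j := fun hj => hx ⟨hi, hj⟩
      simp [clusterFunction, hj]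
    · simp [clusterFunction, hi]

theorem IsNCluster.variationVector_clusterFunction (hbdd : Bornology.IsBounded Ω)
    (hE : IsNCluster Ω E) : variationVector (clusterFunction E) = ratio E := by
  ext i
  simp only [variationVector, ratio, clusterFunction]
  rw [totalVariation_indicator (hE.volume_pos i) (volume_lt_top_of_diff_null hbdd (hE.subset i))]

theorem functionalEigenvalue_le_cheegerH (hbdd : Bornology.IsBounded Ω) :
    functionalEigenvalue Φ Ω ≤ cheegerH Φ Ω :=
  le_iInf₂ fun _ hE => by
    rw [← hE.variationVector_clusterFunction hbdd]
    exact functionalEigenvalue_le (hE.isOneNFunction hbdd)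

theorem IsOneNFunction.isNCluster_superlevel (hu : IsOneNFunction Ω u) {t : Fin N → ℝ}
    (ht : ∀ i, 0 < t i) (hpos : ∀ i, 0 < volume (superlevel u t i))
    (hper : ∀ i, perimeter (superlevel u t i) < ∞) : IsNCluster Ω (superlevel u t) where
  nullMeasurableSet i := (hu.memBVZero i).nullMeasurableSet_superlevel (t i)
  subset i := (hu.memBVZero i).volume_superlevel_diff (ht i)
  volume_pos := hpos
  disjoint i j hij := by
    have h1 := hu.mul_eq_zero i j hij
    have h2 := (hu.memBVZero i).ae_eq_zero
    refine measure_mono_null (fun x hx => ?_) (ae_iff.1 (h1.and h2))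
    rintro ⟨h3, h4⟩
    have hi : 0 < u i x := (ht i).trans hx.1
    have hj : 0 < u j x := (ht j).trans hx.2
    by_cases hxΩ : x ∈ Ω
    · exact (mul_pos hi hj).ne' (h3 hxΩ)
    · exact hi.ne' (h4 hxΩ)
  perimeter_lt_top := hper

theorem IsOneNFunction.volume_superlevel_lt_top (hbdd : Bornology.IsBounded Ω)
    (hu : IsOneNFunction Ω u) (i : Fin N) {t : ℝ} (ht : 0 < t) :
    volume {x | t < u i x} < ∞ :=
  volume_lt_top_of_diff_null hbdd ((hu.memBVZero i).volume_superlevel_diff ht)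

/-- Each level is chosen from its own component alone, since disjointness of the superlevel sets
holds for all positive levels. -/
theorem IsOneNFunction.exists_ratio_superlevel_le (hbdd : Bornology.IsBounded Ω)
    (hΩ : MeasurableSet Ω) (hu : IsOneNFunction Ω u) :
    ∃ t, IsNCluster Ω (superlevel u t) ∧ ratio (superlevel u t) ≤ variationVector u := by
  choose t ht hm hp using fun i => (hu.memBVZero i).exists_perimeter_superlevel_le hbdd hΩ
    (hu.nonneg i) (hu.norm_eq_one i)
  have hfin := fun i => (hu.memBVZero i).totalVariation_lt_top
  refine ⟨t, hu.isNCluster_superlevel ht hm fun i => (hp i).trans_lt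
    (ENNReal.mul_lt_top (hfin i) (hu.volume_superlevel_lt_top hbdd i (ht i))), fun i => ?_⟩
  exact ENNReal.toNNReal_mono (hfin i).ne (ENNReal.div_le_of_le_mul (hp i))

theorem functionalEigenvalue_eq_cheegerH (hbdd : Bornology.IsBounded Ω) (hΩ : MeasurableSet Ω)
    (hΦ : Monotone Φ) : functionalEigenvalue Φ Ω = cheegerH Φ Ω := by
  refine le_antisymm (functionalEigenvalue_le_cheegerH hbdd) (le_iInf₂ fun u hu => ?_)
  obtain ⟨t, hcl, hle⟩ := hu.exists_ratio_superlevel_le hbdd hΩ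
  exact (cheegerH_le hcl).trans (ENNReal.coe_le_coe.2 (hΦ hle))

/-- Replacing one component by the normalized characteristic function of a superlevel set. -/
theorem IsOneNFunction.update_superlevel (hbdd : Bornology.IsBounded Ω)
    (hu : IsOneNFunction Ω u) (i : Fin N) {t : ℝ} (ht : 0 < t)
    (hpos : 0 < volume {x | t < u i x}) (hper : perimeter {x | t < u i x} < ∞) :
    IsOneNFunction Ω (Function.update u i
      ({x | t < u i x}.indicator fun _ => (volume {x | t < u i x}).toReal⁻¹)) := by
  have hm := (hu.memBVZero i).nullMeasurableSet_superlevel t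
  have hfin := hu.volume_superlevel_lt_top hbdd i ht
  have hzero : ∀ j, i ≠ j → ∀ᵐ x, x ∈ Ω →
      {x | t < u i x}.indicator (fun _ => (volume {x | t < u i x}).toReal⁻¹) x * u j x = 0 := by
    intro j hij
    filter_upwards [hu.mul_eq_zero i j hij] with x hx hxΩ
    by_cases h : t < u i x
    · rw [(_root_.mul_eq_zero.1 (hx hxΩ)).resolve_left (ht.trans h).ne', mul_zero]
    · simp [h]
  refine ⟨fun j => ?_, fun j => ?_, fun j => ?_, fun j k hjk => ?_⟩
  · rcases eq_or_ne j i with rfl | hj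
    · rw [Function.update_self]
      exact memBVZero_indicator hbdd hm ((hu.memBVZero j).volume_superlevel_diff ht) hper
    · rw [Function.update_of_ne hj]; exact hu.memBVZero j
  · rcases eq_or_ne j i with rfl | hj
    · rw [Function.update_self]
      exact ae_of_all _ fun x => Set.indicator_nonneg (fun _ _ => by positivity) x
    · rw [Function.update_of_ne hj]; exact hu.nonneg j
  · rcases eq_or_ne j i with rfl | hj
    · rw [Function.update_self]; exact integral_abs_indicator hm hpos hfin
    · rw [Function.update_of_ne hj]; exact hu.norm_eq_one j
  · rcases eq_or_ne j i with rfl | hj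
    · rw [Function.update_self, Function.update_of_ne hjk.symm]; exact hzero k hjk
    · rw [Function.update_of_ne hj]
      rcases eq_or_ne k i with rfl | hk
      · rw [Function.update_self]
        filter_upwards [hzero j hj.symm] with x hx hxΩ
        rw [mul_comm, hx hxΩ]
      · rw [Function.update_of_ne hk]; exact hu.mul_eq_zero j k hjk

/-- Otherwise replacing `u i` by the normalized indicator of this superlevel set would strictly
lower one entry of the variation vector and keep the others. -/
theorem IsEigenFunction.mul_volume_superlevel_le (hbdd : Bornology.IsBounded Ω)
    (hΦ : StrictMono Φ) (hu : IsEigenFunction Φ Ω u) (i : Fin N) {t : ℝ} (ht : 0 < t) :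
    totalVariation (u i) * volume {x | t < u i x} ≤ perimeter {x | t < u i x} := by
  by_contra! hlt
  have hD := (hu.1.memBVZero i).totalVariation_lt_top
  have hfin := hu.1.volume_superlevel_lt_top hbdd i ht
  have hpos : 0 < volume {x | t < u i x} := by
    rw [pos_iff_ne_zero]
    intro h
    simp [h] at hlt
  have hup := hu.1.update_superlevel hbdd i ht hpos hlt.ne_top.lt_top
  have hvar : variationVector (Function.update u i
      ({x | t < u i x}.indicator fun _ => (volume {x | t < u i x}).toReal⁻¹))
      = Function.update (variationVector u) i
        (perimeter {x | t < u i x} / volume {x | t < u i x}).toNNReal := by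
    ext j
    rcases eq_or_ne j i with rfl | hj
    · simp only [variationVector, Function.update_self, totalVariation_indicator hpos hfin]
    · simp only [variationVector, Function.update_of_ne hj]
  have h1 := functionalEigenvalue_le (Φ := Φ) hup
  rw [← hu.2, hvar, ENNReal.coe_le_coe] at h1
  refine (apply_update_lt_of_strictMono hΦ ?_).not_ge h1
  exact toNNReal_div_lt ((ENNReal.div_lt_iff (.inl hpos.ne') (.inl hfin.ne)).2 hlt) hD.ne

theorem IsNCluster.update (hE : IsNCluster Ω E) (i : Fin N) {F : Set (Eucl d)}
    (hF : NullMeasurableSet F) (hsub : volume (F \ (Ω \ ⋃ (j : Fin N) (_ : j ≠ i), E j)) = 0)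
    (hpos : 0 < volume F) (hper : perimeter F < ∞) : IsNCluster Ω (Function.update E i F) := by
  have hzero : ∀ j, j ≠ i → volume (F ∩ E j) = 0 := fun j hj => by
    refine measure_mono_null (fun x hx => ?_) hsub
    exact ⟨hx.1, fun h => h.2 (Set.mem_biUnion (s := {j | j ≠ i}) hj hx.2)⟩
  refine { nullMeasurableSet := fun j => ?_, subset := fun j => ?_, volume_pos := fun j => ?_,
           disjoint := fun j k hjk => ?_, perimeter_lt_top := fun j => ?_ }
  · rcases eq_or_ne j i with rfl | hj
    · rwa [Function.update_self]
    · rw [Function.update_of_ne hj]; exact hE.nullMeasurableSet j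
  · rcases eq_or_ne j i with rfl | hj
    · rw [Function.update_self]
      exact measure_mono_null (Set.sdiff_subset_sdiff_right Set.sdiff_subset) hsub
    · rw [Function.update_of_ne hj]; exact hE.subset j
  · rcases eq_or_ne j i with rfl | hj
    · rwa [Function.update_self]
    · rw [Function.update_of_ne hj]; exact hE.volume_pos j
  · rcases eq_or_ne j i with rfl | hj
    · rw [Function.update_self, Function.update_of_ne hjk.symm]; exact hzero k hjk.symm
    · rw [Function.update_of_ne hj]
      rcases eq_or_ne k i with rfl | hk
      · rw [Function.update_self, Set.inter_comm]; exact hzero j hj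
      · rw [Function.update_of_ne hk]; exact hE.disjoint j k hjk
  · rcases eq_or_ne j i with rfl | hj
    · rwa [Function.update_self]
    · rw [Function.update_of_ne hj]; exact hE.perimeter_lt_top j

/-- A set of smaller ratio in the complement of the other chambers could replace the `i`-th chamber
and strictly decrease `Φ`. Conversely, the chamber itself competes in the Cheeger constant. -/
theorem IsCheegerCluster.isOneAdjusted (hbdd : Bornology.IsBounded Ω) (hΦ : StrictMono Φ)
    (hE : IsCheegerCluster Φ Ω E) : IsOneAdjusted Ω E := by
  refine ⟨hE.1, fun i => le_antisymm (le_iInf₂ fun F hF => ?_) ?_⟩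
  · by_contra! hlt
    obtain ⟨hFm, hFs, hF0⟩ := hF
    have hfin : volume F < ∞ := volume_lt_top_of_diff_null hbdd
      (measure_mono_null (Set.sdiff_subset_sdiff_right Set.sdiff_subset) hFs)
    have hper : perimeter F < ∞ := by
      rw [lt_top_iff_ne_top]
      intro h
      rw [h, ENNReal.top_div_of_ne_top hfin.ne] at hlt
      exact not_top_lt hlt
    have hup := hE.1.update i hFm hFs hF0 hper
    have hrat : ratio (Function.update E i F)
        = Function.update (ratio E) i (perimeter F / volume F).toNNReal := by
      ext j
      rcases eq_or_ne j i with rfl | hj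
      · simp only [ratio, Function.update_self]
      · simp only [ratio, Function.update_of_ne hj]
    have h1 := cheegerH_le (Φ := Φ) hup
    rw [← hE.2, hrat, ENNReal.coe_le_coe] at h1
    exact (apply_update_lt_of_strictMono hΦ (toNNReal_div_lt hlt (hE.1.div_ne_top i))).not_ge h1
  · refine cheeger_le (hE.1.nullMeasurableSet i) ?_ (hE.1.volume_pos i)
    rw [Set.sdiff_sdiff_right, Set.inter_iUnion₂]
    refine measure_union_null (hE.1.subset i) ?_
    exact measure_iUnion_null fun j => measure_iUnion_null fun hj => hE.1.disjoint i j hj.symm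

theorem IsEigenFunction.exists_null_sets (hbdd : Bornology.IsBounded Ω) (hΩ : MeasurableSet Ω)
    (hΦ : StrictMono Φ) (hu : IsEigenFunction Φ Ω u) :
    ∃ Z : Fin N → Set ℝ, (∀ i, volume (Z i) = 0) ∧ ∀ t : Fin N → ℝ,
      (∀ i, t i ∉ Z i ∧ 0 < t i ∧ 0 < volume (superlevel u t i)) →
        IsOneAdjusted Ω (superlevel u t) ∧ IsCheegerCluster Φ Ω (superlevel u t) := by
  have hae := fun i => (hu.1.memBVZero i).ae_perimeter_superlevel_eq hbdd hΩ
    (hu.1.nonneg i) (hu.1.norm_eq_one i) fun t ht => hu.mul_volume_superlevel_le hbdd hΦ i ht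
  -- `Z i` is the set of positive levels at which the ratio identity for `u i` fails, so it depends
  -- on the `i`-th component only.
  refine ⟨_, fun i => ae_iff.1 (hae i), fun t ht => ?_⟩
  have heq : ∀ i, perimeter (superlevel u t i)
      = totalVariation (u i) * volume (superlevel u t i) := fun i =>
    not_not.1 (ht i).1 (ht i).2.1
  have hfin : ∀ i, volume (superlevel u t i) < ∞ := fun i =>
    hu.1.volume_superlevel_lt_top hbdd i (ht i).2.1
  have hcl : IsNCluster Ω (superlevel u t) :=
    hu.1.isNCluster_superlevel (fun i => (ht i).2.1) (fun i => (ht i).2.2) fun i => by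
      rw [heq i]
      exact ENNReal.mul_lt_top (hu.1.memBVZero i).totalVariation_lt_top (hfin i)
  have hrat : ratio (superlevel u t) = variationVector u := by
    ext i
    simp only [ratio, variationVector]
    rw [heq i, ENNReal.mul_div_cancel_right (ht i).2.2.ne' (hfin i).ne]
  have hch : IsCheegerCluster Φ Ω (superlevel u t) :=
    ⟨hcl, by rw [hrat, hu.2, functionalEigenvalue_eq_cheegerH hbdd hΩ hΦ.monotone]⟩
  exact ⟨hch.isOneAdjusted hbdd hΦ, hch⟩

/-- Minimality of one cluster suffices, provided that all its ratios dominate the variations of `u`.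
Such a level vector exists because a product of non-negligible sets is not negligible, so it meets
the full-measure set of good vectors. -/
theorem IsOneNFunction.isEigenFunction_of_ae (hbdd : Bornology.IsBounded Ω)
    (hΩ : MeasurableSet Ω) (hΦ : Monotone Φ) (hu : IsOneNFunction Ω u)
    (h : ∀ᵐ t : Fin N → ℝ, (∀ i, 0 < t i ∧ 0 < volume (superlevel u t i)) →
      IsCheegerCluster Φ Ω (superlevel u t)) : IsEigenFunction Φ Ω u := by
  set S : Fin N → Set ℝ := fun i => {t : ℝ | 0 < t ∧ 0 < volume {x | t < u i x} ∧
    totalVariation (u i) * volume {x | t < u i x} ≤ perimeter {x | t < u i x}} with hS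
  have hS0 : volume (Set.univ.pi S) ≠ 0 := by
    -- The product formula holds for arbitrary sets, so the measurability of `S i` is not at issue.
    rw [volume_pi, Measure.pi_pi, Finset.prod_ne_zero_iff]
    exact fun i _ => (hu.memBVZero i).volume_setOf_le_perimeter_superlevel_ne_zero
      (hu.nonneg i) (hu.norm_eq_one i)
  obtain ⟨t, htS, ht⟩ : ∃ t ∈ Set.univ.pi S, (∀ i, 0 < t i ∧ 0 < volume (superlevel u t i)) →
      IsCheegerCluster Φ Ω (superlevel u t) := by
    by_contra! hcon
    refine hS0 (measure_mono_null (fun t htS => ?_) (ae_iff.1 h))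
    exact fun h' => (hcon t htS).2 (h' (hcon t htS).1)
  have htS' : ∀ i, t i ∈ S i := fun i => htS i (Set.mem_univ i)
  have hch := ht fun i => ⟨(htS' i).1, (htS' i).2.1⟩
  have hle : variationVector u ≤ ratio (superlevel u t) := fun i =>
    ENNReal.toNNReal_mono (hch.1.div_ne_top i)
      ((ENNReal.le_div_iff_mul_le (.inl (htS' i).2.1.ne')
        (.inl (hu.volume_superlevel_lt_top hbdd i (htS' i).1).ne)).2 (htS' i).2.2)
  refine ⟨hu, le_antisymm ?_ (functionalEigenvalue_le hu)⟩
  rw [functionalEigenvalue_eq_cheegerH hbdd hΩ hΦ, ← hch.2]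
  exact ENNReal.coe_le_coe.2 (hΦ hle)

theorem ae_notMem_of_null {Z : Fin N → Set ℝ} (hZ : ∀ i, volume (Z i) = 0) :
    ∀ᵐ t : Fin N → ℝ, ∀ i, t i ∉ Z i :=
  ae_all_iff.2 fun i => (Measure.quasiMeasurePreserving_eval (fun _ : Fin N => volume) i).ae
    (compl_mem_ae_iff.2 (hZ i))

theorem IsCheegerCluster.isEigenFunction (hbdd : Bornology.IsBounded Ω) (hΩ : MeasurableSet Ω)
    (hΦ : Monotone Φ) (hE : IsCheegerCluster Φ Ω E) :
    IsEigenFunction Φ Ω (clusterFunction E) :=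
  ⟨hE.1.isOneNFunction hbdd, by
    rw [hE.1.variationVector_clusterFunction hbdd, hE.2,
      functionalEigenvalue_eq_cheegerH hbdd hΩ hΦ]⟩

end Clusters

end NCheeger

theorem mainTheorem2 (d N : ℕ) (Ω : Set (Eucl d)) (hne : Ω.Nonempty)
    (hbdd : Bornology.IsBounded Ω) (hopen : IsOpen Ω) (Φ : (Fin N → ℝ≥0) → ℝ≥0) :
    (Monotone Φ → functionalEigenvalue Φ Ω = cheegerH Φ Ω) ∧
    (StrictMono Φ →
      (∀ u : Fin N → Eucl d → ℝ, IsOneNFunction Ω u →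
        -- the condition for almost every vector `t = (t_1, …, t_N)`
        ((IsEigenFunction Φ Ω u ↔
            ∀ᵐ t : Fin N → ℝ, (∀ i, 0 < t i ∧ 0 < volume (superlevel u t i)) →
              IsOneAdjusted Ω (superlevel u t) ∧ IsCheegerCluster Φ Ω (superlevel u t)) ∧
        -- the condition for almost every `t_i`, separately in each `i`
          (IsEigenFunction Φ Ω u ↔
            ∃ Z : Fin N → Set ℝ, (∀ i, volume (Z i) = 0) ∧
              ∀ t : Fin N → ℝ,
                (∀ i, t i ∉ Z i ∧ 0 < t i ∧ 0 < volume (superlevel u t i)) →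
                  IsOneAdjusted Ω (superlevel u t) ∧
                    IsCheegerCluster Φ Ω (superlevel u t)))) ∧
      (∀ E : Fin N → Set (Eucl d), IsCheegerCluster Φ Ω E →
        IsEigenFunction Φ Ω (clusterFunction E))) := by
  have hΩ : MeasurableSet Ω := hopen.measurableSet
  refine ⟨functionalEigenvalue_eq_cheegerH hbdd hΩ, fun hΦ => ⟨fun u hu => ?_,
    fun E hE => hE.isEigenFunction hbdd hΩ hΦ.monotone⟩⟩
  have hae : (∃ Z : Fin N → Set ℝ, (∀ i, volume (Z i) = 0) ∧ ∀ t : Fin N → ℝ,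
      (∀ i, t i ∉ Z i ∧ 0 < t i ∧ 0 < volume (superlevel u t i)) →
        IsOneAdjusted Ω (superlevel u t) ∧ IsCheegerCluster Φ Ω (superlevel u t)) →
      ∀ᵐ t : Fin N → ℝ, (∀ i, 0 < t i ∧ 0 < volume (superlevel u t i)) →
        IsOneAdjusted Ω (superlevel u t) ∧ IsCheegerCluster Φ Ω (superlevel u t) := by
    rintro ⟨Z, hZ, h⟩
    filter_upwards [ae_notMem_of_null hZ] with t ht hpos
    exact h t fun i => ⟨ht i, hpos i⟩
  have hback : (∀ᵐ t : Fin N → ℝ, (∀ i, 0 < t i ∧ 0 < volume (superlevel u t i)) →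
        IsOneAdjusted Ω (superlevel u t) ∧ IsCheegerCluster Φ Ω (superlevel u t)) →
      IsEigenFunction Φ Ω u := fun h =>
    hu.isEigenFunction_of_ae hbdd hΩ hΦ.monotone (h.mono fun t ht hpos => (ht hpos).2)
  have hforth : IsEigenFunction Φ Ω u → _ := fun h => h.exists_null_sets hbdd hΩ hΦ
  exact ⟨⟨fun h => hae (hforth h), hback⟩, ⟨hforth, fun h => hback (hae h)⟩⟩
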